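/- Let $K$ be an arbitrary field and let $F|K$ be an algebraic function field, i.e. a finitely generated field extension, of transcendence degree $n$. Let $S(F|K)$ be the set of all places of $F$ that are trivial on $K$ (up to equivalence), that is, of all valuation rings of $F$ containing $K$; for a place $P$ write $\mathcal O_P$ for its valuation ring, $\mathcal M_P$ for the maximal ideal, $FP$ for the residue field and $v_PF$ for the value group. Equip $S(F|K)$ with the patch topology, whose basic open sets are $$\{P\in S(F|K)\mid a_1,\dots,a_k\in\mathcal O_P;\ b_1,\dots,b_\ell\in\mathcal M_P\},\qquad k,\ell\ge 0,\ a_i,b_j\in F.$$ A place $P$ is called rational if $FP=K$, discrete if $v_PF\cong\mathbb Z$, and of maximal rank if the number of proper convex subgroups of the ordered abelian group $v_PF$ equals $n$. It admits smooth local uniformization if for any finitely many $a_1,\dots,a_m\in\mathcal O_P$ there is a finitely generated $K$-subalgebra $A\subseteq\mathcal O_P$ with quotient field $F$ and $a_1,\dots,a_m\in A$ such that the center $A\cap\mathcal M_P$ of $P$ is a smooth point of $\operatorname{Spec}A$ over $K$. Then in the patch topology the closure of the set of all rational places of maximal rank contains every rational place of $F|K$ that admits smooth local uniformization, and if $n\geq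 1$, then so does the closure of the set of all rational discrete places. -/

import Mathlib

/-- A place of `F|K`, up to equivalence: a valuation ring of `F` that contains `K`.
The type of all of them is the Zariski space `S(F|K)`. -/
@[ext]
structure ZariskiSpace (K F : Type*) [Field K] [Field F] [Algebra K F] where
  /-- The valuation ring `𝒪_P` of the place. -/
  ring : ValuationSubring F
  algebraMap_mem : ∀ c : K, algebraMap K F c ∈ ring

namespace ZariskiSpace

variable {K F : Type*} [Field K] [Field F] [Algebra K F]

/-- The basic set `{P | a ∈ 𝒪_P for a ∈ s, b ∈ ℳ_P for b ∈ t}` of the patch topology.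
Here `nonunits` is the maximal ideal `ℳ_P`, viewed inside `F`. -/
def patchBasic (s t : Finset F) : Set (ZariskiSpace K F) :=
  {P | (∀ a ∈ s, a ∈ P.ring) ∧ ∀ b ∈ t, b ∈ P.ring.nonunits}

/-- The patch (constructible) topology on `S(F|K)`. -/
instance patchTopology : TopologicalSpace (ZariskiSpace K F) :=
  TopologicalSpace.generateFrom {U | ∃ s t : Finset F, U = patchBasic s t}

/-- The basic sets are stable under finite intersection and cover the space, hence they form
a basis of the patch topology. -/
theorem isTopologicalBasis_patchBasic :
    TopologicalSpace.IsTopologicalBasis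
      {U : Set (ZariskiSpace K F) | ∃ s t : Finset F, U = patchBasic s t} := by
  classical
  refine ⟨?_, ?_, rfl⟩
  · rintro _ ⟨s, t, rfl⟩ _ ⟨s', t', rfl⟩ P ⟨h, h'⟩
    refine ⟨patchBasic (s ∪ s') (t ∪ t'), ⟨_, _, rfl⟩, ?_, ?_⟩
    · refine ⟨fun a ha => ?_, fun a ha => ?_⟩
      · exact (Finset.mem_union.1 ha).elim (h.1 a) (h'.1 a)
      · exact (Finset.mem_union.1 ha).elim (h.2 a) (h'.2 a)
    · intro R hR
      exact ⟨⟨fun a ha => hR.1 a (Finset.mem_union_left _ ha),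
          fun a ha => hR.2 a (Finset.mem_union_left _ ha)⟩,
        ⟨fun a ha => hR.1 a (Finset.mem_union_right _ ha),
          fun a ha => hR.2 a (Finset.mem_union_right _ ha)⟩⟩
  · refine Set.eq_univ_of_forall fun P => ?_
    exact ⟨patchBasic ∅ ∅, ⟨_, _, rfl⟩, by simp [patchBasic]⟩

variable (P : ZariskiSpace K F)

/-- The inclusion of the constants `K` in the valuation ring `𝒪_P`. -/
def constants : K →+* P.ring :=
  (algebraMap K F).codRestrict P.ring P.algebraMap_mem

/-- `P` is rational: the canonical map from `K` to the residue field `FP` is onto. -/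
def IsRational : Prop :=
  Function.Surjective ((IsLocalRing.residue P.ring).comp P.constants)

/-- The value group `v_P F`, written multiplicatively
(`ValuationSubring.ValueGroup` is the value group together with a zero). -/
abbrev ValueGroup : Type _ := (P.ring.ValueGroup)ˣ

/-- `P` is discrete: its value group is isomorphic to `ℤ` as an ordered group. -/
def IsDiscrete : Prop :=
  Nonempty (P.ValueGroup ≃*o Multiplicative ℤ)

/-- The rank of `v_P F`: the number of its proper convex subgroups. -/
noncomputable def rank : Cardinal :=
  Cardinal.mk {H : Subgroup P.ValueGroup // H ≠ ⊤ ∧ (H : Set P.ValueGroup).OrdConnected}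

/-- `P` is of maximal rank: the rank of `v_P F` equals the transcendence degree of `F|K`. -/
def IsOfMaximalRank : Prop :=
  P.rank = Algebra.trdeg K F

/-- The center of `P` on the affine model with coordinate ring `A ⊆ 𝒪_P`: the prime ideal
`A ∩ ℳ_P`. -/
noncomputable def center (A : Subalgebra K F) (hA : ∀ x ∈ A, x ∈ P.ring) : PrimeSpectrum A :=
  PrimeSpectrum.comap (A.val.toRingHom.codRestrict P.ring fun x => hA x x.2)
    (IsLocalRing.closedPoint P.ring)

/-- `P` admits smooth local uniformization: for any finitely many elements of `𝒪_P`, there is an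
affine model of `F|K`, i.e. a finitely generated `K`-subalgebra `A` of `F` with quotient
field `F`, which contains these elements and on which `P` is centered at a smooth point. -/
def AdmitsSmoothLocalUniformization : Prop :=
  ∀ s : Finset F, (∀ a ∈ s, a ∈ P.ring) →
    ∃ (A : Subalgebra K F) (hA : ∀ x ∈ A, x ∈ P.ring),
      A.FG ∧ IsFractionRing A F ∧ (∀ a ∈ s, a ∈ A) ∧
        P.center A hA ∈ Algebra.smoothLocus K A

end ZariskiSpace

/-! A patch neighbourhood of a rational place `Q` involves finitely many elements of `𝒪_Q`. Put them
in a model `A` on which `Q` has a smooth center; as `Q` is rational, the center is a `K`-point `ρ :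
A → K`. Any rational place `P` with `A ⊆ 𝒪_P` whose maximal ideal contains the center of `Q` lies in
the neighbourhood, so it suffices to build such `P` with a controlled value group.

Near the center, `A` is étale over affine `d`-space, with `d` the transcendence degree. Since power
series rings are adically complete, the étale coordinates, shifted to vanish at `ρ`, can be sent to
any series `b i` without constant term, and the map lifts to `A` with constant term `ρ`
(`exists_powerSeries_embedding_of_etale`). If the `b i` are algebraically independent, the lift is
injective, because a nonzero ideal in an algebraic extension domain meets the base. The
lexicographic valuation on `K⟦X₁, …, X_m⟧` pulls back to `A` and extends to `F`; comparing leading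
coefficients shows that its residue field is `K` (`exists_place_of_embedding`).

For `m = 1` the value group lies in `ℤ`, and is nontrivial once `d > 0`; independent series exist by
counting over the prime field. For `m = d` and `b = X` the value group is all of lexicographic
`ℤ^d`, which has exactly `d` proper convex subgroups. -/

/-! ### The lexicographic valuation on power series. -/

namespace MvPowerSeries

/-- Natural exponents, viewed as integral exponents with the lexicographic order. -/
def lexExponent {m : ℕ} (d : Lex (Fin m →₀ ℕ)) : Lex (Fin m → ℤ) :=
  toLex fun i => (ofLex d i : ℤ)

theorem lexExponent_zero {m : ℕ} : lexExponent (0 : Lex (Fin m →₀ ℕ)) = 0 := by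
  apply ofLex.injective; funext i; simp [lexExponent]; rfl

theorem lexExponent_add {m : ℕ} (d e : Lex (Fin m →₀ ℕ)) :
    lexExponent (d + e) = lexExponent d + lexExponent e := by
  apply ofLex.injective; funext i
  change ((ofLex d i + ofLex e i : ℕ) : ℤ) = (ofLex d i : ℤ) + ofLex e i
  simp

theorem lexExponent_strictMono {m : ℕ} : StrictMono (lexExponent (m := m)) := by
  intro d e h
  obtain ⟨i, h, h'⟩ := h
  exact ⟨i, fun j hj => by simpa [lexExponent] using h j hj, by simpa [lexExponent] using h'⟩

/-- The ordered group of values of the lexicographic valuation, with a zero. -/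
abbrev LexValues (m : ℕ) : Type := WithZero (Multiplicative (Lex (Fin m → ℤ)))

/-- The multiplicative counterpart of an order in `WithTop (Lex (Fin m →₀ ℕ))`. -/
noncomputable def lexValueOf {m : ℕ} (d : WithTop (Lex (Fin m →₀ ℕ))) : LexValues m :=
  d.recTopCoe 0 fun d =>
    ((Multiplicative.ofAdd (-(lexExponent d)) : Multiplicative _) : LexValues m)

@[simp] theorem lexValueOf_top {m : ℕ} : lexValueOf (⊤ : WithTop (Lex (Fin m →₀ ℕ))) = 0 := rfl

@[simp] theorem lexValueOf_coe {m : ℕ} (d : Lex (Fin m →₀ ℕ)) :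
    lexValueOf (d : WithTop (Lex (Fin m →₀ ℕ))) =
      ((Multiplicative.ofAdd (-(lexExponent d)) : Multiplicative _) : LexValues m) := rfl

theorem lexValueOf_strictAnti {m : ℕ} : StrictAnti (lexValueOf (m := m)) := by
  intro d e h
  induction d with
  | top => simp at h
  | coe d =>
    induction e with
    | top => simp [WithZero.zero_lt_coe]
    | coe e =>
      simp only [lexValueOf_coe, WithZero.coe_lt_coe, Multiplicative.ofAdd_lt, neg_lt_neg_iff]
      exact lexExponent_strictMono (WithTop.coe_lt_coe.1 h)

theorem lexValueOf_add {m : ℕ} (d e : WithTop (Lex (Fin m →₀ ℕ))) :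
    lexValueOf (d + e) = lexValueOf d * lexValueOf e := by
  induction d with
  | top => simp
  | coe d =>
    induction e with
    | top => simp
    | coe e =>
      rw [← WithTop.coe_add]
      simp only [lexValueOf_coe, lexExponent_add, neg_add, ofAdd_add, WithZero.coe_mul]

theorem lexValueOf_zero {m : ℕ} : lexValueOf (0 : WithTop (Lex (Fin m →₀ ℕ))) = 1 := by
  change lexValueOf ((0 : Lex (Fin m →₀ ℕ)) : WithTop (Lex (Fin m →₀ ℕ))) = 1
  rw [lexValueOf_coe, lexExponent_zero, neg_zero, ofAdd_zero, WithZero.coe_one]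

variable {K : Type*} [Field K] {m : ℕ}

theorem lexOrder_one : lexOrder (1 : MvPowerSeries (Fin m) K) = 0 := by
  apply le_antisymm
  · exact lexOrder_le_of_coeff_ne_zero (d := 0) (by simp)
  · obtain ⟨d, hd⟩ := exists_finsupp_eq_lexOrder_of_ne_zero
      (one_ne_zero (α := MvPowerSeries (Fin m) K))
    rw [hd]
    exact WithTop.coe_le_coe.2 (zero_le)

variable (K m) in
/-- The lexicographic valuation on power series in `m` variables. -/
noncomputable def lexValuation : Valuation (MvPowerSeries (Fin m) K) (LexValues m) where
  toFun f := lexValueOf (lexOrder f)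
  map_zero' := by simp
  map_one' := by rw [lexOrder_one, lexValueOf_zero]
  map_mul' f g := by rw [lexOrder_mul, lexValueOf_add]
  map_add_le_max' f g := by
    rw [← lexValueOf_strictAnti.antitone.map_min]
    exact lexValueOf_strictAnti.antitone min_lexOrder_le

theorem lexValuation_apply (f : MvPowerSeries (Fin m) K) :
    lexValuation K m f = lexValueOf (lexOrder f) := rfl

theorem lexValuation_eq_zero_iff {f : MvPowerSeries (Fin m) K} :
    lexValuation K m f = 0 ↔ f = 0 := by
  rw [lexValuation_apply, ← lexValueOf_top, lexValueOf_strictAnti.injective.eq_iff,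
    lexOrder_eq_top_iff_eq_zero]

theorem lexOrder_nonneg (f : MvPowerSeries (Fin m) K) : 0 ≤ lexOrder f := by
  by_cases hf : f = 0
  · simp [hf]
  obtain ⟨d, hd⟩ := exists_finsupp_eq_lexOrder_of_ne_zero hf
  rw [hd]
  exact WithTop.coe_le_coe.2 (zero_le)

theorem lexValuation_le_one (f : MvPowerSeries (Fin m) K) : lexValuation K m f ≤ 1 := by
  rw [lexValuation_apply, ← lexValueOf_zero]
  exact lexValueOf_strictAnti.antitone (lexOrder_nonneg f)

theorem lexValuation_lt_one {f : MvPowerSeries (Fin m) K} (hf : constantCoeff f = 0) :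
    lexValuation K m f < 1 := by
  rw [lexValuation_apply, ← lexValueOf_zero]
  refine lexValueOf_strictAnti (lt_of_le_of_ne (lexOrder_nonneg f) fun h => ?_)
  exact coeff_ne_zero_of_lexOrder (d := 0) h (by simpa using hf)

/-- Leading coefficients: the residue field of the lexicographic valuation is `K`. -/
theorem exists_lexValuation_sub_lt {f g : MvPowerSeries (Fin m) K} (hg : g ≠ 0)
    (hfg : lexValuation K m f ≤ lexValuation K m g) :
    ∃ c : K, lexValuation K m (f - C c * g) < lexValuation K m g := by
  obtain ⟨d, hd⟩ := exists_finsupp_eq_lexOrder_of_ne_zero hg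
  have hgd : coeff d g ≠ 0 := coeff_ne_zero_of_lexOrder hd.symm
  -- Both series vanish below `d`, and this constant cancels the coefficient at `d`; it is zero when
  -- `f` has strictly smaller value.
  refine ⟨coeff d f / coeff d g, ?_⟩
  rw [lexValuation_apply, lexValuation_apply] at hfg
  have hle := lexValueOf_strictAnti.le_iff_ge.1 hfg
  refine lexValueOf_strictAnti (lt_of_le_of_ne ?_ fun h => ?_)
  · rw [le_lexOrder_iff]
    intro e he
    rw [map_sub, coeff_C_mul, coeff_eq_zero_of_lt_lexOrder he,
      coeff_eq_zero_of_lt_lexOrder (he.trans_le hle)]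
    simp
  · refine coeff_ne_zero_of_lexOrder (hd.symm.trans h) ?_
    rw [map_sub, coeff_C_mul, div_mul_cancel₀ _ hgd, sub_self]

theorem lexValuation_X (i : Fin m) :
    lexValuation K m (X i : MvPowerSeries (Fin m) K) =
      ((Multiplicative.ofAdd (-(toLex (Pi.single i 1))) : Multiplicative (Lex (Fin m → ℤ))) :
        LexValues m) := by
  classical
  have h : lexOrder (X i : MvPowerSeries (Fin m) K) = toLex (Finsupp.single i 1) := by
    have hX : (X i : MvPowerSeries (Fin m) K) ≠ 0 := by
      intro h
      have := congrArg (coeff (Finsupp.single i 1)) h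
      simp [coeff_X] at this
    obtain ⟨d, hd⟩ := exists_finsupp_eq_lexOrder_of_ne_zero hX
    have := coeff_ne_zero_of_lexOrder hd.symm
    rw [coeff_X] at this
    rw [hd]
    split_ifs at this with h
    · rw [h]
    · exact absurd rfl this
  rw [lexValuation_apply, h, lexValueOf_coe]
  congr 3
  apply ofLex.injective
  funext j
  by_cases hj : j = i
  · subst hj; simp [lexExponent]
  · simp [lexExponent, Finsupp.single_apply, hj, Ne.symm hj]

end MvPowerSeries

/-! ### Convex subgroups of lexicographic powers of `ℤ`. -/

/-- The leading index of a nonzero vector. -/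
theorem exists_leading_index {n : ℕ} {v : Fin n → ℤ} (hv : v ≠ 0) :
    ∃ j, v j ≠ 0 ∧ ∀ i < j, v i = 0 := by
  obtain ⟨k, hk⟩ := Function.ne_iff.1 hv
  obtain ⟨j, hj, hmin⟩ := WellFounded.has_min (wellFounded_lt (α := Fin n)) {i | v i ≠ 0} ⟨k, hk⟩
  exact ⟨j, hj, fun i hi => by_contra fun h => hmin i h hi⟩

section ConvexSubgroups

variable {G : Type*} [CommGroup G] [LinearOrder G] {n : ℕ}
  (e : G ≃*o Multiplicative (Lex (Fin n → ℤ)))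

/-- The coordinates of an element of a group isomorphic to a lexicographic power of `ℤ`. -/
noncomputable def lexCoord (g : G) : Fin n → ℤ := ofLex (Multiplicative.toAdd (e g))

theorem lexCoord_one : lexCoord e 1 = 0 := by
  simp only [lexCoord, map_one]; rfl

theorem lexCoord_mul (g h : G) : lexCoord e (g * h) = lexCoord e g + lexCoord e h := by
  simp only [lexCoord, map_mul]; rfl

theorem lexCoord_inv (g : G) : lexCoord e g⁻¹ = -lexCoord e g := by
  simp only [lexCoord, map_inv]; rfl

theorem lexCoord_pow (g : G) (k : ℕ) : lexCoord e (g ^ k) = k • lexCoord e g := by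
  simp only [lexCoord, map_pow]; rfl

theorem lexCoord_lt_iff {g h : G} : g < h ↔ toLex (lexCoord e g) < toLex (lexCoord e h) := by
  rw [← e.strictMono.lt_iff_lt]; rfl

theorem lexCoord_symm (v : Fin n → ℤ) :
    lexCoord e (e.symm (Multiplicative.ofAdd (toLex v))) = v := by
  simp only [lexCoord, OrderMonoidIso.apply_symm_apply]; rfl

theorem lt_of_lexCoord {g h : G} (j : Fin n) (h₁ : ∀ i < j, lexCoord e g i = lexCoord e h i)
    (h₂ : lexCoord e g j < lexCoord e h j) : g < h :=
  (lexCoord_lt_iff e).2 ⟨j, h₁, h₂⟩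

/-- The convex subgroup of all elements whose coordinates up to `j` vanish. -/
def lexSubgroup (j : Fin n) : Subgroup G where
  carrier := {g | ∀ i ≤ j, lexCoord e g i = 0}
  one_mem' i _ := by simp [lexCoord_one]
  mul_mem' {g h} hg hh i hi := by simp [lexCoord_mul, hg i hi, hh i hi]
  inv_mem' {g} hg i hi := by simp [lexCoord_inv, hg i hi]

theorem mem_lexSubgroup {j : Fin n} {g : G} :
    g ∈ lexSubgroup e j ↔ ∀ i ≤ j, lexCoord e g i = 0 := Iff.rfl

theorem lexSubgroup_ordConnected (j : Fin n) :
    (lexSubgroup e j : Set G).OrdConnected := by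
  refine ⟨fun a ha b hb c hc => ?_⟩
  by_contra hcj
  obtain ⟨k, hk, hck⟩ : ∃ k ≤ j, lexCoord e c k ≠ 0 := by
    simpa [mem_lexSubgroup] using hcj
  -- Both bounds `a` and `b` vanish up to the leading index `l ≤ j` of `c`, so the sign of the
  -- coordinate `c_l` puts `c` below `a` or above `b`.
  obtain ⟨l, hl, hmin⟩ := exists_leading_index (v := lexCoord e c) (fun h => hck (by simp [h]))
  have hlj : l ≤ j := (le_of_not_gt fun h => hck (hmin k h)).trans hk
  rcases hl.lt_or_gt with h | h
  · refine (lt_of_lexCoord e (g := c) (h := a) l (fun i hi => ?_) ?_).not_ge hc.1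
    · rw [hmin i hi, ha i (hi.le.trans hlj)]
    · rwa [ha l hlj]
  · refine (lt_of_lexCoord e (g := b) (h := c) l (fun i hi => ?_) ?_).not_ge hc.2
    · rw [hmin i hi, hb i (hi.le.trans hlj)]
    · rwa [hb l hlj]

/-- Basis vectors detect the index `j`, which makes these subgroups proper and pairwise distinct. -/
theorem symm_single_mem_lexSubgroup_iff {j k : Fin n} :
    e.symm (Multiplicative.ofAdd (toLex (Pi.single k 1))) ∈ lexSubgroup e j ↔ j < k := by
  rw [mem_lexSubgroup, lexCoord_symm]
  constructor
  · intro h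
    by_contra hkj
    simpa using h k (not_lt.1 hkj)
  · intro h i hi
    simp [(hi.trans_lt h).ne]

theorem lexSubgroup_ne_top (j : Fin n) : lexSubgroup e j ≠ ⊤ := by
  intro h
  have := (symm_single_mem_lexSubgroup_iff e (j := j) (k := j)).1 (by rw [h]; trivial)
  exact this.false

theorem lexSubgroup_injective : Function.Injective (lexSubgroup e) := by
  intro j k h
  have key : ∀ l, j < l ↔ k < l := fun l => by
    rw [← symm_single_mem_lexSubgroup_iff e, h, symm_single_mem_lexSubgroup_iff]
  apply le_antisymm
  · exact not_lt.1 fun hh => ((key j).2 hh).false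
  · exact not_lt.1 fun hh => ((key k).1 hh).false

/-- A convex subgroup is determined by the leading indices of its elements. -/
theorem mem_of_leading_index [IsOrderedMonoid G] {H : Subgroup G}
    (hH : (H : Set G).OrdConnected) {g h : G}
    (hh : h ∈ H) {j : Fin n} (hj : lexCoord e h j ≠ 0) (hmin : ∀ i < j, lexCoord e h i = 0)
    (hg : ∀ i < j, lexCoord e g i = 0) : g ∈ H := by
  wlog hpos : 0 < lexCoord e h j generalizing h
  · refine this (H.inv_mem hh) (by simpa [lexCoord_inv] using hj)
      (fun i hi => by simp [lexCoord_inv, hmin i hi]) ?_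
    have := lt_of_le_of_ne (not_lt.1 hpos) hj
    simpa [lexCoord_inv] using this
  -- As the `j`-th coordinate of `h` is at least 1, this power squeezes `g` between `h⁻ᴺ` and `hᴺ`;
  -- the summand 1 makes the inequalities strict.
  set N : ℕ := (lexCoord e g j).natAbs + 1 with hN
  have hNg : |lexCoord e g j| < N * lexCoord e h j := by
    have : |lexCoord e g j| < N := by rw [hN]; push_cast; simp
    nlinarith
  refine hH.out (H.inv_mem (H.pow_mem hh N)) (H.pow_mem hh N) ⟨le_of_lt ?_, le_of_lt ?_⟩
  · refine lt_of_lexCoord e j (fun i hi => ?_) ?_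
    · simp [lexCoord_inv, lexCoord_pow, hmin i hi, hg i hi]
    · simp only [lexCoord_inv, lexCoord_pow, Pi.neg_apply, nsmul_eq_mul]
      exact (abs_lt.1 hNg).1
  · refine lt_of_lexCoord e j (fun i hi => ?_) ?_
    · simp [lexCoord_pow, hmin i hi, hg i hi]
    · simp only [lexCoord_pow, Pi.smul_apply, nsmul_eq_mul]
      exact (abs_lt.1 hNg).2

/-- The set `S` of leading indices of elements of `H` is upward closed and determines `H`. The
largest index outside `S`, which exists because `H` is proper, is the required `j`. -/
theorem exists_eq_lexSubgroup [IsOrderedMonoid G] {H : Subgroup G}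
    (hH : (H : Set G).OrdConnected) (hne : H ≠ ⊤) :
    ∃ j, lexSubgroup e j = H := by
  let S : Set (Fin n) := {j | ∃ h ∈ H, lexCoord e h j ≠ 0 ∧ ∀ i < j, lexCoord e h i = 0}
  have hsub : ∀ g, (∀ i, i ∉ S → lexCoord e g i = 0) → g ∈ H := by
    intro g hg
    by_cases h0 : lexCoord e g = 0
    · have : g = 1 := by
        apply e.injective
        rw [map_one]
        exact h0
      rw [this]; exact H.one_mem
    obtain ⟨j, hj, hmin⟩ := exists_leading_index h0
    obtain ⟨h, hh, hhj, hhmin⟩ : j ∈ S := by_contra fun h => hj (hg j h)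
    exact mem_of_leading_index e hH hh hhj hhmin hmin
  have hup : ∀ j ∈ S, ∀ k, j < k → k ∈ S := by
    rintro j ⟨h, hh, hhj, hhmin⟩ k hjk
    refine ⟨e.symm (Multiplicative.ofAdd (toLex (Pi.single k 1))), ?_, ?_, ?_⟩
    · refine mem_of_leading_index e hH hh hhj hhmin fun i hi => ?_
      rw [lexCoord_symm]
      simp [(hi.trans hjk).ne]
    · rw [lexCoord_symm]; simp
    · intro i hi
      rw [lexCoord_symm]
      simp [hi.ne]
  obtain ⟨k, hk⟩ : ∃ k, k ∉ S := by
    by_contra! h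
    exact hne ((Subgroup.eq_top_iff' H).2 fun g => hsub g fun i hi => absurd (h i) hi)
  obtain ⟨j, hj, hmax⟩ := WellFounded.has_min (wellFounded_gt (α := Fin n)) Sᶜ ⟨k, hk⟩
  refine ⟨j, le_antisymm (fun g hg => hsub g fun i hi => hg i ?_) fun g hg i hi => ?_⟩
  · by_contra hgi
    obtain ⟨l, hl, hmin⟩ := exists_leading_index (v := lexCoord e g) (fun h => hgi (by simp [h]))
    have hlS : l ∈ S := ⟨g, hg, hl, hmin⟩
    have hlj : l ≤ j := (le_of_not_gt fun h => hgi (hmin i h)).trans hi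
    rcases hlj.eq_or_lt with h | h
    · exact hj (h ▸ hlS)
    · exact hj (hup l hlS j h)
  · exact not_lt.1 fun h => hmax i hi h

/-- The lexicographic power `ℤⁿ` has rank `n`. -/
theorem mk_convex_subgroups_eq [IsOrderedMonoid G] (e : G ≃*o Multiplicative (Lex (Fin n → ℤ))) :
    Cardinal.mk {H : Subgroup G // H ≠ ⊤ ∧ (H : Set G).OrdConnected} = n := by
  rw [← Cardinal.lift_natCast.{_, 0}, ← Cardinal.mk_fin,
    ← Cardinal.lift_id'.{0} (Cardinal.mk {H // _})]
  refine (Cardinal.lift_mk_eq'.2 ⟨Equiv.ofBijective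
    (fun j => ⟨lexSubgroup e j, lexSubgroup_ne_top e j, lexSubgroup_ordConnected e j⟩)
    ⟨fun j k h => lexSubgroup_injective e (congrArg Subtype.val h), fun H => ?_⟩⟩).symm
  obtain ⟨j, hj⟩ := exists_eq_lexSubgroup e H.2.2 H.2.1
  exact ⟨j, Subtype.ext hj⟩

end ConvexSubgroups

/-! ### Rational places from embeddings in power series rings. -/

/-- The value group of a valuation subring embeds in the values of any valuation that defines it. -/
theorem Valuation.exists_valueGroup_hom {F Γ : Type*} [Field F] [LinearOrderedCommGroupWithZero Γ]
    (w : Valuation F Γ) :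
    ∃ φ : (w.valuationSubring.ValueGroup)ˣ →* Γˣ, StrictMono φ ∧
      ∀ x : F, w x ≠ 0 → ∃ u, (φ u : Γ) = w x := by
  have heq : w.IsEquiv w.valuationSubring.valuation := w.isEquiv_valuation_valuationSubring
  have hs : ∀ γ : w.valuationSubring.ValueGroup, ∃ x, w.valuationSubring.valuation x = γ :=
    w.valuationSubring.valuation_surjective
  choose r hr using hs
  -- Equivalent valuations identify the same elements, so `w (r γ)` does not depend on the
  -- representative and is multiplicative in `γ`.
  have key : ∀ x, w (r (w.valuationSubring.valuation x)) = w x := fun x => heq.eq_iff.2 (hr _)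
  let ψ : w.valuationSubring.ValueGroup →* Γ :=
    { toFun := fun γ => w (r γ)
      map_one' := by rw [← map_one w.valuationSubring.valuation, key, map_one]
      map_mul' := fun a b => by
        rw [← map_mul, heq.eq_iff, hr, map_mul, hr, hr] }
  refine ⟨Units.map ψ, fun a b hab => ?_, fun x hx => ?_⟩
  · rw [← Units.val_lt_val] at hab ⊢
    change w (r a) < w (r b)
    rwa [heq.lt_iff_lt, hr, hr]
  · have hx' : w.valuationSubring.valuation x ≠ 0 := heq.eq_zero.ne.1 hx
    exact ⟨Units.mk0 _ hx', key x⟩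

namespace ZariskiSpace

open MvPowerSeries

variable {K F : Type*} [Field K] [Field F] [Algebra K F]

/-- An embedding of an affine model in a ring of power series over `K` whose coordinate ring is
centered at the origin yields a rational place. -/
theorem exists_place_of_embedding {A : Subalgebra K F} [IsFractionRing A F] {m : ℕ}
    (φ : A →ₐ[K] MvPowerSeries (Fin m) K) (hφ : Function.Injective φ) :
    ∃ P : ZariskiSpace K F, P.IsRational ∧ (∀ a : A, (a : F) ∈ P.ring) ∧
      (∀ a : A, constantCoeff (φ a) = 0 → (a : F) ∈ P.ring.nonunits) ∧
      ∃ Φ : P.ValueGroup →* Multiplicative (Lex (Fin m → ℤ)), StrictMono Φ ∧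
        ∀ a s : A, ∀ f, f ≠ 0 → s ≠ 0 → φ a = f * φ s →
          ∃ u, ((Φ u : Multiplicative (Lex (Fin m → ℤ))) : LexValues m) = lexValuation K m f := by
  let v : Valuation A (LexValues m) := (lexValuation K m).comap (φ : A →+* MvPowerSeries (Fin m) K)
  have hv : ∀ a, v a = lexValuation K m (φ a) := fun a => rfl
  have hv0 : ∀ a, v a = 0 ↔ a = 0 := fun a => by
    rw [hv, lexValuation_eq_zero_iff, map_eq_zero_iff φ hφ]
  -- Injectivity of `φ` makes the support of `v` zero, which is what extending to the fraction field
  -- requires.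
  have hS : nonZeroDivisors A ≤ v.supp.primeCompl := by
    intro a ha h
    exact nonZeroDivisors.ne_zero ha ((hv0 a).1 h)
  let w : Valuation F (LexValues m) := v.extendToLocalization hS F
  have hw : ∀ a : A, w a = lexValuation K m (φ a) := fun a =>
    v.extendToLocalization_apply_map_apply hS F a
  have hwle : ∀ a : A, w a ≤ 1 := fun a => by rw [hw]; exact lexValuation_le_one _
  let P : ZariskiSpace K F :=
    { ring := w.valuationSubring
      algebraMap_mem := fun c => hwle (algebraMap K A c) }
  have hnu : ∀ x : F, x ∈ P.ring.nonunits ↔ w x < 1 := fun x => by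
    rw [ValuationSubring.mem_nonunits_iff]
    exact (w.isEquiv_valuation_valuationSubring.lt_one_iff_lt_one).symm
  refine ⟨P, ?_, hwle, fun a ha => ?_, ?_⟩
  · intro y
    obtain ⟨x, rfl⟩ := IsLocalRing.residue_surjective y
    obtain ⟨a, s, hs, hx⟩ := IsFractionRing.div_surjective (A := A) (x : F)
    have hs0 : s ≠ 0 := nonZeroDivisors.ne_zero hs
    have hφs : φ s ≠ 0 := (map_ne_zero_iff φ hφ).2 hs0
    have hsF : (s : F) ≠ 0 := fun h => hs0 (Subtype.ext h)
    have hws : w s ≠ 0 := (Valuation.ne_zero_iff w).2 hsF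
    have hx' : (x : F) = (a : F) / s := hx.symm
    have hle : w x ≤ 1 := x.2
    rw [hx', map_div₀, div_le_one₀ (zero_lt_iff.2 hws), hw, hw] at hle
    obtain ⟨c, hc⟩ := exists_lexValuation_sub_lt hφs hle
    refine ⟨c, ?_⟩
    rw [RingHom.comp_apply, eq_comm, ← sub_eq_zero, ← map_sub, IsLocalRing.residue_eq_zero_iff,
      ValuationSubring.valuation_lt_one_iff,
      ← w.isEquiv_valuation_valuationSubring.lt_one_iff_lt_one]
    have hxc : (((x - P.constants c : P.ring)) : F) = ((a - c • s : A) : F) / s := by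
      have : (((x - P.constants c : P.ring)) : F) = (x : F) - algebraMap K F c := rfl
      rw [this, hx']
      push_cast
      rw [Algebra.smul_def]
      field_simp
    change w ((x - P.constants c : P.ring) : F) < 1
    rw [hxc, map_div₀, div_lt_one₀ (zero_lt_iff.2 hws), hw, hw, map_sub, map_smul,
      smul_eq_C_mul]
    exact hc
  · rw [hnu, hw]
    exact lexValuation_lt_one ha
  · obtain ⟨Φ, hΦ, hΦw⟩ := w.exists_valueGroup_hom
    let E : (LexValues m)ˣ ≃*o Multiplicative (Lex (Fin m → ℤ)) := OrderMonoidIso.unitsWithZero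
    refine ⟨(E : (LexValues m)ˣ →* _).comp Φ, E.strictMono.comp hΦ, fun a s f hf hs h => ?_⟩
    have hs' : lexValuation K m (φ s) ≠ 0 := fun h =>
      hs ((map_eq_zero_iff φ hφ).1 (lexValuation_eq_zero_iff.1 h))
    -- The series `f` need not be in the image of `φ`; the fraction `a / s` represents it in `F`.
    have hval : w ((a : F) / s) = lexValuation K m f := by
      rw [map_div₀, hw, hw, h, map_mul, mul_div_cancel_right₀ _ hs']
    obtain ⟨u, hu⟩ := hΦw ((a : F) / s) (by rwa [hval, Ne, lexValuation_eq_zero_iff])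
    refine ⟨u, ?_⟩
    rw [← hval, ← hu]
    exact WithZero.coe_unzero _

end ZariskiSpace

/-! ### Algebraically independent power series. -/

/-- Algebraic independence of power series descends to the field generated by coefficients. -/
theorem MvPowerSeries.algebraicIndependent_map {k K ι σ : Type*} [Field k] [Field K] [Algebra k K]
    {y : ι → MvPowerSeries σ k} (hy : AlgebraicIndependent k y) :
    AlgebraicIndependent K fun i => MvPowerSeries.map (algebraMap k K) (y i) := by
  rw [algebraicIndependent_iff]
  intro p hp
  by_contra hne
  obtain ⟨d, hd⟩ := MvPolynomial.ne_zero_iff.1 hne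
  -- The `y i` have coefficients in `k`, so applying `l` to all coefficients turns a relation over
  -- `K` into one over `k`, nontrivial by the choice of `l`.
  obtain ⟨l, hl⟩ : ∃ l : K →ₗ[k] k, l (p.coeff d) ≠ 0 := by
    by_contra! h
    exact hd ((Module.forall_dual_apply_eq_zero_iff k _).1 h)
  let q : MvPolynomial ι k := ∑ s ∈ p.support, MvPolynomial.monomial s (l (p.coeff s))
  have hq : q.coeff d = l (p.coeff d) := by
    classical
    simp only [q, MvPolynomial.coeff_sum, MvPolynomial.coeff_monomial]
    rw [Finset.sum_ite_eq', if_pos (MvPolynomial.mem_support_iff.2 hd)]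
  have hq0 : MvPolynomial.aeval y q = 0 := by
    ext e
    have := congrArg (fun f => l (MvPowerSeries.coeff e f)) hp
    simp only [map_zero, MvPolynomial.aeval_def, MvPolynomial.eval₂_eq] at this
    rw [map_zero, ← this, map_sum, map_sum, map_sum, map_sum]
    refine Finset.sum_congr rfl fun s _ => ?_
    rw [MvPolynomial.aeval_monomial]
    simp only [← map_pow, ← map_prod]
    rw [← Algebra.smul_def, ← Algebra.smul_def, MvPowerSeries.coeff_smul,
      MvPowerSeries.coeff_smul, MvPowerSeries.coeff_map, mul_comm (p.coeff s),
      ← Algebra.smul_def, map_smul, smul_eq_mul, mul_comm]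
    rfl
  have := (algebraicIndependent_iff.1 hy) q hq0
  exact hl (by rw [← hq, this, MvPolynomial.coeff_zero])

/-- Power series in one variable over a countable field contain arbitrarily many algebraically
independent elements. -/
theorem MvPowerSeries.exists_algebraicIndependent_of_countable (k : Type*) [Field k] [Countable k]
    (σ : Type) [Nonempty σ] (d : ℕ) :
    ∃ y : Fin d → MvPowerSeries σ k, AlgebraicIndependent k y := by
  obtain ⟨s, hs⟩ := exists_isTranscendenceBasis k (MvPowerSeries σ k)
  -- A finite transcendence basis would make the power series ring algebraic over a countable ring,
  -- hence countable, but the series with coefficients 0 and 1 are already uncountable.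
  have hinf : s.Infinite := by
    intro hfin
    have : Countable s := hfin.countable
    have hc : Countable (Algebra.adjoin k s) := by
      rw [Algebra.adjoin_eq_range]
      have : Countable (MvPolynomial s k) := by
        rw [← Cardinal.mk_le_aleph0_iff]
        refine MvPolynomial.cardinalMk_le_max_lift.trans ?_
        simp
      exact (Set.countable_range _).to_subtype
    have halg : Algebra.IsAlgebraic (Algebra.adjoin k s) (MvPowerSeries σ k) := by
      have := hs.isAlgebraic
      rwa [Subtype.range_coe] at this
    have : IsDomain (MvPowerSeries σ k) := NoZeroDivisors.to_isDomain _
    have hc' : Countable (MvPowerSeries σ k) := by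
      rw [← Cardinal.mk_le_aleph0_iff]
      refine (Algebra.IsAlgebraic.cardinalMk_le_max (Algebra.adjoin k s) _).trans ?_
      simp
    have hu : Uncountable ((σ →₀ ℕ) → Bool) := by
      have i : σ := Classical.arbitrary σ
      have : Function.Injective (fun (f : ℕ → Bool) (e : σ →₀ ℕ) => f (e i)) := fun f g h =>
        funext fun n => by simpa using congrFun h (Finsupp.single i n)
      have hnat : Uncountable (ℕ → Bool) := by
        rw [← Cardinal.aleph0_lt_mk_iff]
        simpa using Cardinal.cantor Cardinal.aleph0
      exact this.uncountable
    have : Function.Injective (fun (f : (σ →₀ ℕ) → Bool) =>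
        (fun e => if f e then 1 else 0 : MvPowerSeries σ k)) := fun f g h =>
      funext fun e => by
        have := congrFun h e
        cases hf : f e <;> cases hg : g e <;> simp_all
    exact (not_countable_iff.2 this.uncountable) hc'
  obtain ⟨f⟩ : Nonempty (Fin d ↪ s) := by
    have := hinf.to_subtype
    exact ⟨(Fin.valEmbedding).trans (Infinite.natEmbedding s)⟩
  exact ⟨_, hs.1.comp f f.injective⟩

/-- Adding constants preserves algebraic independence. -/
theorem AlgebraicIndependent.add_algebraMap {R A ι : Type*} [CommRing R] [CommRing A] [Algebra R A]
    {x : ι → A} (hx : AlgebraicIndependent R x) (c : ι → R) :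
    AlgebraicIndependent R fun i => x i + algebraMap R A (c i) := by
  have h : MvPolynomial.aeval (fun i => x i + algebraMap R A (c i)) =
      (MvPolynomial.aeval x).comp
        (MvPolynomial.aeval (R := R) fun i => MvPolynomial.X i + MvPolynomial.C (c i)) := by
    ext i; simp
  have hinj : Function.Injective (MvPolynomial.aeval (R := R) fun i =>
      (MvPolynomial.X i + MvPolynomial.C (c i) : MvPolynomial ι R)) := by
    refine Function.LeftInverse.injective
      (g := MvPolynomial.aeval fun i => MvPolynomial.X i - MvPolynomial.C (c i)) fun p => ?_
    rw [← AlgHom.comp_apply]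
    conv_rhs => rw [← AlgHom.id_apply (R := R) p]
    congr 1
    ext i; simp
  unfold AlgebraicIndependent
  rw [h]
  exact (show Function.Injective (MvPolynomial.aeval (R := R) x) from hx).comp hinj

/-- Counting over `K` itself can fail, since `K` may be as large as `K⟦X⟧`. The prime field is
countable, and independence over it survives the passage to `K`; constant terms are then subtracted.
-/
theorem MvPowerSeries.exists_algebraicIndependent (K : Type*) [Field K] (d : ℕ) :
    ∃ y : Fin d → MvPowerSeries (Fin 1) K, AlgebraicIndependent K y ∧
      ∀ i, constantCoeff (y i) = 0 := by
  have : Countable (⊥ : Subfield K) := by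
    rw [← Subfield.closure_empty, ← Cardinal.mk_le_aleph0_iff]
    exact (Subfield.cardinalMk_closure_le_max ∅).trans (by simp)
  obtain ⟨y, hy⟩ := exists_algebraicIndependent_of_countable (⊥ : Subfield K) (Fin 1) d
  have hy' := MvPowerSeries.algebraicIndependent_map (K := K) hy
  refine ⟨_, hy'.add_algebraMap fun i => -constantCoeff (MvPowerSeries.map (algebraMap _ K) (y i)),
    fun i => ?_⟩
  simp [MvPowerSeries.algebraMap_apply]

/-! ### Étale coordinates and embeddings of smooth models. -/

/-- A compatible pair of maps from `R` to an adically
complete ring `B` and from an étale algebra `S` to `B ⧸ I` comes from a map `S → B`. -/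
theorem RingHom.Etale.exists_lift {R S B : Type*} [CommRing R] [CommRing S] [CommRing B]
    {g : R →+* S} (hg : g.Etale) (β : R →+* B) (I : Ideal B) [IsAdicComplete I B]
    (f : S →+* B ⧸ I) (h : f.comp g = (Ideal.Quotient.mk I).comp β) :
    ∃ ψ : S →+* B, ψ.comp g = β ∧ (Ideal.Quotient.mk I).comp ψ = f := by
  let := g.toAlgebra
  let := β.toAlgebra
  have : Algebra.Etale R S := hg
  let f' : S →ₐ[R] B ⧸ I := { f with commutes' := fun r => RingHom.congr_fun h r }
  obtain ⟨ψ, hψ⟩ := Algebra.FormallySmooth.exists_mkₐ_comp_eq_of_isAdicComplete f'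
  exact ⟨ψ, ψ.comp_algebraMap, RingHom.ext fun s => AlgHom.congr_fun hψ s⟩

/-- The fraction field of an étale domain over a domain is algebraic. -/
theorem RingHom.Etale.isAlgebraic {R S F : Type*} [CommRing R] [IsDomain R] [CommRing S]
    [IsDomain S] [Field F] [Algebra S F] [IsFractionRing S F] [Algebra R S] [Algebra R F]
    [IsScalarTower R S F] (hg : (algebraMap R S).Etale)
    (hinj : Function.Injective (algebraMap R S)) : Algebra.IsAlgebraic R F := by
  have : Algebra.Etale R S := RingHom.etale_algebraMap.1 hg
  have : FaithfulSMul R F := by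
    rw [faithfulSMul_iff_algebraMap_injective, IsScalarTower.algebraMap_eq R S F]
    exact (IsFractionRing.injective S F).comp hinj
  let L := FractionRing R
  let : Algebra L F := FractionRing.liftAlgebra R F
  have : IsScalarTower R L F := FractionRing.isScalarTower_liftAlgebra R F
  -- Unramifiedness and essential finite type pass to `F` over `L = Frac R`, and such a field
  -- extension is separable, hence algebraic.
  have : Algebra.FormallyUnramified S F := .of_isLocalization (nonZeroDivisors S)
  have : Algebra.FormallyUnramified R F := .comp R S F
  have : Algebra.FormallyUnramified L F := .of_restrictScalars R L F
  have : Algebra.EssFiniteType S F := .of_isLocalization F (nonZeroDivisors S)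
  have : Algebra.EssFiniteType R F := .comp R S F
  have : Algebra.EssFiniteType L F := .of_comp R L F
  have : Algebra.IsSeparable L F := Algebra.FormallyUnramified.isSeparable L F
  have : Algebra.IsAlgebraic L F := inferInstance
  exact (IsFractionRing.comap_isAlgebraic_iff (A := R) (K := L) (C := F)).2 this

open MvPowerSeries in
/-- The ideal generated by the variables contains all power series without constant term. -/
theorem MvPowerSeries.mem_span_range_X {R : Type*} [CommRing R] {m : ℕ}
    {f : MvPowerSeries (Fin m) R} (hf : constantCoeff f = 0) :
    f ∈ Ideal.span (Set.range (X : Fin m → MvPowerSeries (Fin m) R)) := by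
  classical
  -- Each monomial of `f` is assigned to the first variable dividing it, so `X i * g i` collects
  -- exactly the monomials whose first variable is `X i`.
  let g : Fin m → MvPowerSeries (Fin m) R := fun i e =>
    if ∀ j < i, e j = 0 then coeff (e + Finsupp.single i 1) f else 0
  have hg : ∀ i e, coeff e (g i) =
      if ∀ j < i, e j = 0 then coeff (e + Finsupp.single i 1) f else 0 := fun i e => rfl
  have hsum : f = ∑ i, X i * g i := by
    ext e
    simp only [map_sum, X_def, coeff_monomial_mul, one_mul, hg]
    by_cases he : e = 0
    · subst he
      rw [Finset.sum_eq_zero fun i _ => if_neg fun h => by simpa using h i]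
      simpa using hf
    obtain ⟨k, hk⟩ := Finsupp.ne_iff.1 he
    obtain ⟨i, hi, hmin⟩ := WellFounded.has_min (wellFounded_lt (α := Fin m)) {i | e i ≠ 0} ⟨k, hk⟩
    have hmin' : ∀ j < i, e j = 0 := fun j hj => by_contra fun h => hmin j h hj
    have hle : ∀ j, e j ≠ 0 → Finsupp.single j 1 ≤ e := fun j hj => by
      rw [Finsupp.single_le_iff]; exact Nat.one_le_iff_ne_zero.2 hj
    rw [Finset.sum_eq_single_of_mem i (Finset.mem_univ _), if_pos (hle i hi), if_pos,
      tsub_add_cancel_of_le (hle i hi)]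
    · intro j hj
      simp [hmin' j hj]
    · intro j _ hji
      by_cases hej : e j = 0
      · rw [if_neg fun h => ?_]
        have := h j
        simp [hej] at this
      · have hij : i < j := lt_of_le_of_ne (not_lt.1 (hmin j hej)) hji.symm
        rw [if_pos (hle j hej), if_neg fun h => hi ?_]
        simpa [Finsupp.single_apply, hji] using h i hij
  rw [hsum]
  exact Ideal.sum_mem _ fun i _ => Ideal.mul_mem_right _ _ (Ideal.subset_span ⟨i, rfl⟩)

theorem MvPowerSeries.constantCoeff_eq_zero_of_mem_span {R : Type*} [CommRing R] {m : ℕ}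
    {f : MvPowerSeries (Fin m) R}
    (hf : f ∈ Ideal.span (Set.range (X : Fin m → MvPowerSeries (Fin m) R))) :
    constantCoeff f = 0 := by
  have : Ideal.span (Set.range (X : Fin m → MvPowerSeries (Fin m) R)) ≤
      RingHom.ker (constantCoeff (σ := Fin m) (R := R)) := by
    rw [Ideal.span_le]
    rintro _ ⟨i, rfl⟩
    exact constantCoeff_X i
  exact this hf

theorem MvPowerSeries.algebraicIndependent_X (R : Type*) [CommRing R] (σ : Type*) :
    AlgebraicIndependent R (X : σ → MvPowerSeries σ R) := by
  have h : (MvPolynomial.aeval (R := R) (X : σ → MvPowerSeries σ R) : MvPolynomial σ R → _) =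
      fun p : MvPolynomial σ R => (p : MvPowerSeries σ R) := by
    have : MvPolynomial.aeval (R := R) (X : σ → MvPowerSeries σ R) =
        MvPolynomial.coeToMvPowerSeries.algHom R := by
      ext i; simp
    funext p
    rw [this]
    simp [MvPolynomial.coeToMvPowerSeries.algHom_apply, MvPowerSeries.map_id]
  unfold AlgebraicIndependent
  rw [h]
  exact MvPolynomial.coe_injective σ R

/-- An étale chart `S` of an affine model around a rational point with coordinates
`g : K[X₁, …, X_d] → S` maps to power series rings with prescribed algebraically independent values
of the (centered) coordinates. -/
theorem exists_powerSeries_embedding_of_etale {K F S : Type*} [Field K] [Field F] [CommRing S]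
    [IsDomain S] [Algebra K S] [Algebra K F] [Algebra S F] [IsScalarTower K S F]
    [IsFractionRing S F] {d : ℕ} (g : MvPolynomial (Fin d) K →+* S)
    (hgC : g.comp MvPolynomial.C = algebraMap K S) (hg : g.Etale) (ρ : S →ₐ[K] K) :
    Algebra.trdeg K F = d ∧ ∀ (m : ℕ) (b : Fin d → MvPowerSeries (Fin m) K),
      (∀ i, MvPowerSeries.constantCoeff (b i) = 0) → AlgebraicIndependent K b →
      ∃ ψ : S →ₐ[K] MvPowerSeries (Fin m) K, Function.Injective ψ ∧
        (∀ s, MvPowerSeries.constantCoeff (ψ s) = ρ s) ∧ ∀ i, ∃ s, ψ s = b i := by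
  let r : Fin d → K := fun i => ρ (g (MvPolynomial.X i))
  have hρC : ∀ c : K, ρ (g (MvPolynomial.C c)) = c := fun c => by
    rw [← RingHom.comp_apply, hgC, AlgHom.commutes]; rfl
  -- Lifting, without injectivity.
  have lift : ∀ (m : ℕ) (b : Fin d → MvPowerSeries (Fin m) K),
      (∀ i, MvPowerSeries.constantCoeff (b i) = 0) →
      ∃ ψ : S →ₐ[K] MvPowerSeries (Fin m) K,
        (∀ p, ψ (g p) = MvPolynomial.aeval
          (fun i => b i + algebraMap K (MvPowerSeries (Fin m) K) (r i)) p) ∧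
        ∀ s, MvPowerSeries.constantCoeff (ψ s) = ρ s := by
    intro m b hb
    let I := Ideal.span (Set.range (MvPowerSeries.X : Fin m → MvPowerSeries (Fin m) K))
    let β : MvPolynomial (Fin d) K →ₐ[K] MvPowerSeries (Fin m) K :=
      MvPolynomial.aeval (fun i => b i + algebraMap K (MvPowerSeries (Fin m) K) (r i))
    let f : S →+* MvPowerSeries (Fin m) K ⧸ I :=
      ((Ideal.Quotient.mk I).comp (algebraMap K _)).comp (ρ : S →+* K)
    have hf : f.comp g = (Ideal.Quotient.mk I).comp (β : _ →+* _) := by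
      refine MvPolynomial.ringHom_ext (fun c => ?_) fun i => ?_
      · simp only [f, RingHom.comp_apply, RingHom.coe_coe]
        rw [hρC]
        congr 1
        exact (β.commutes c).symm
      · simp only [f, β, RingHom.comp_apply, RingHom.coe_coe, MvPolynomial.aeval_X, map_add]
        rw [Ideal.Quotient.eq_zero_iff_mem.2 (MvPowerSeries.mem_span_range_X (hb i)), zero_add]
    obtain ⟨ψ, hψ, hψ'⟩ := hg.exists_lift (β : _ →+* _) I f hf
    refine ⟨{ ψ with commutes' := fun c => ?_ }, fun p => RingHom.congr_fun hψ p, fun s => ?_⟩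
    · have := RingHom.congr_fun hψ (MvPolynomial.C c)
      rw [RingHom.comp_apply, ← RingHom.comp_apply g, hgC] at this
      exact this.trans (β.commutes c)
    · have h1 : Ideal.Quotient.mk I (ψ s - algebraMap K _ (ρ s)) = 0 := by
        rw [map_sub, sub_eq_zero]
        exact RingHom.congr_fun hψ' s
      have h2 := MvPowerSeries.constantCoeff_eq_zero_of_mem_span
        (Ideal.Quotient.eq_zero_iff_mem.1 h1)
      rw [map_sub, sub_eq_zero] at h2
      refine h2.trans ?_
      simp [MvPowerSeries.algebraMap_apply]
  have inj : ∀ (m : ℕ) (b : Fin d → MvPowerSeries (Fin m) K), AlgebraicIndependent K b →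
      Function.Injective (MvPolynomial.aeval (R := K)
        (fun i => b i + algebraMap K (MvPowerSeries (Fin m) K) (r i))) := fun m b hb =>
    hb.add_algebraMap r
  -- Lifting the independent family `X` already shows that `g` is injective, before algebraicity of
  -- `F` over the polynomial ring is available.
  have hginj : Function.Injective g := by
    obtain ⟨ψ, hψ, -⟩ := lift d MvPowerSeries.X fun i => MvPowerSeries.constantCoeff_X i
    refine Function.Injective.of_comp (f := ψ) ?_
    convert inj d _ (MvPowerSeries.algebraicIndependent_X K (Fin d)) using 1
    exact funext hψ
  let := g.toAlgebra
  let : Algebra (MvPolynomial (Fin d) K) F := ((algebraMap S F).comp g).toAlgebra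
  have : IsScalarTower (MvPolynomial (Fin d) K) S F := .of_algebraMap_eq fun _ => rfl
  have : IsScalarTower K (MvPolynomial (Fin d) K) F := .of_algebraMap_eq fun c => by
    change algebraMap K F c = algebraMap S F (g (MvPolynomial.C c))
    rw [← RingHom.comp_apply g, hgC, ← IsScalarTower.algebraMap_apply]
  have halg : Algebra.IsAlgebraic (MvPolynomial (Fin d) K) F :=
    RingHom.Etale.isAlgebraic (S := S) hg hginj
  have hFinj : Function.Injective (algebraMap (MvPolynomial (Fin d) K) F) :=
    (IsFractionRing.injective S F).comp hginj
  refine ⟨?_, fun m b hb hbi => ?_⟩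
  · have : FaithfulSMul (MvPolynomial (Fin d) K) F :=
      (faithfulSMul_iff_algebraMap_injective _ _).2 hFinj
    have h := lift_trdeg_add_eq K (MvPolynomial (Fin d) K) F
    rw [trdeg_eq_zero (R := MvPolynomial (Fin d) K), MvPolynomial.trdeg_of_isDomain] at h
    simpa using h.symm
  · obtain ⟨ψ, hψ, hψ'⟩ := lift m b hb
    refine ⟨ψ, ?_, hψ', fun i => ⟨g (MvPolynomial.X i) - algebraMap K S (r i), ?_⟩⟩
    -- A nonzero kernel would contain a nonzero element algebraic over the polynomial ring, hence
    -- meet that ring nontrivially, against the independence of `b`.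
    · rw [← RingHom.coe_coe, RingHom.injective_iff_ker_eq_bot]
      by_contra hker
      obtain ⟨s, hs, hs0⟩ := Submodule.exists_mem_ne_zero_of_ne_bot hker
      have hsalg : IsAlgebraic (MvPolynomial (Fin d) K) s :=
        (isAlgebraic_algebraMap_iff (IsFractionRing.injective S F)).1
          (Algebra.IsAlgebraic.isAlgebraic (algebraMap S F s))
      refine Ideal.comap_ne_bot_of_algebraic_mem hs0 hs hsalg ?_
      rw [RingHom.comap_ker, ← RingHom.injective_iff_ker_eq_bot]
      convert inj m b hbi using 1
      exact funext hψ
    · rw [map_sub, hψ, MvPolynomial.aeval_X, AlgHom.commutes, add_sub_cancel_right]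

/-- Around a smooth rational point `ρ`, an affine model embeds in power series rings with prescribed
algebraically independent values of suitable local coordinates. -/
theorem exists_powerSeries_embedding_of_isSmoothAt {K F : Type*} [Field K] [Field F] [Algebra K F]
    (A : Subalgebra K F) (hA : A.FG) [IsFractionRing A F] (ρ : A →ₐ[K] K) (p : Ideal A) [p.IsPrime]
    (hp : ∀ a, ρ a = 0 → a ∈ p) [Algebra.IsSmoothAt K p] :
    ∃ d : ℕ, Algebra.trdeg K F = d ∧ ∀ (m : ℕ) (b : Fin d → MvPowerSeries (Fin m) K),
      (∀ i, MvPowerSeries.constantCoeff (b i) = 0) → AlgebraicIndependent K b →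
      ∃ φ : A →ₐ[K] MvPowerSeries (Fin m) K, Function.Injective φ ∧
        (∀ a, MvPowerSeries.constantCoeff (φ a) = ρ a) ∧
        ∀ i, ∃ a s, s ≠ 0 ∧ φ a = b i * φ s := by
  have : Algebra.FiniteType K A := (Subalgebra.fg_iff_finiteType A).1 hA
  have : Algebra.FinitePresentation K A := Algebra.FinitePresentation.of_finiteType.1 this
  obtain ⟨f, hf, hsm⟩ := Algebra.IsSmoothAt.exists_notMem_isStandardSmooth K p
  let S := Localization.Away f
  have hf0 : f ≠ 0 := fun h => hf (h ▸ p.zero_mem)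
  have hle : Submonoid.powers f ≤ nonZeroDivisors A :=
    powers_le_nonZeroDivisors_of_noZeroDivisors hf0
  have : IsDomain S := IsLocalization.isDomain_localization hle
  have hSinj : Function.Injective (algebraMap A S) := IsLocalization.injective S hle
  have hunit : IsUnit (algebraMap A F f) := by
    rw [isUnit_iff_ne_zero]
    exact fun h => hf0 (IsFractionRing.injective A F (by rw [h, map_zero]))
  let : Algebra S F := (IsLocalization.Away.lift f hunit : S →+* F).toAlgebra
  have : IsScalarTower A S F := .of_algebraMap_eq fun a =>
    (IsLocalization.Away.lift_eq f hunit a).symm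
  have : IsScalarTower K S F := .to₁₃₄ K A S F
  have : IsFractionRing S F := IsFractionRing.isFractionRing_of_isDomain_of_isLocalization
    (Submonoid.powers f) S F
  -- The kernel of `ρ` lies in `p`, so `ρ` survives on the standard smooth neighbourhood where `f`
  -- is inverted.
  have hρf : IsUnit (ρ f) := isUnit_iff_ne_zero.2 fun h => hf (hp f h)
  let ρ₀ : S →+* K := IsLocalization.Away.lift f (g := (ρ : A →+* K)) hρf
  have hρ₀ : ∀ a, ρ₀ (algebraMap A S a) = ρ a := fun a =>
    IsLocalization.Away.lift_eq f (g := (ρ : A →+* K)) hρf a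
  let ρS : S →ₐ[K] K :=
    { ρ₀ with
      commutes' := fun c => by
        change ρ₀ (algebraMap K S c) = c
        rw [IsScalarTower.algebraMap_apply K A S, hρ₀, AlgHom.commutes]; rfl }
  have hstd : (algebraMap K S).IsStandardSmooth := RingHom.isStandardSmooth_algebraMap.2 hsm
  obtain ⟨d, g, hgC, hg⟩ := hstd.exists_etale_mvPolynomial
  obtain ⟨hd, H⟩ := exists_powerSeries_embedding_of_etale (F := F) g hgC hg ρS
  refine ⟨d, hd, fun m b hb hbi => ?_⟩
  obtain ⟨ψ, hψ, hψ', hψb⟩ := H m b hb hbi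
  refine ⟨ψ.comp (IsScalarTower.toAlgHom K A S), hψ.comp hSinj,
    fun a => (hψ' _).trans (hρ₀ a), fun i => ?_⟩
  obtain ⟨s, hs⟩ := hψb i
  -- The local coordinates live only in the localization `S`; clearing the denominator `t` expresses
  -- them through `A`.
  obtain ⟨a, t, rfl⟩ := IsLocalization.exists_mk'_eq (Submonoid.powers f) s
  refine ⟨a, t, nonZeroDivisors.ne_zero (hle t.2), ?_⟩
  rw [← hs]
  change ψ (algebraMap A S a) = _ * ψ (algebraMap A S t)
  rw [← map_mul, IsLocalization.mk'_spec]

/-! ### Approximating places and their value groups. -/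

namespace ZariskiSpace

variable {K F : Type*} [Field K] [Field F] [Algebra K F]

/-- At a rational place, the residue map of an affine model takes values in `K`. -/
theorem IsRational.exists_residue {Q : ZariskiSpace K F} (hQ : Q.IsRational) (A : Subalgebra K F)
    (hA : ∀ x ∈ A, x ∈ Q.ring) :
    ∃ ρ : A →ₐ[K] K, ∀ a, ρ a = 0 ↔ a ∈ (Q.center A hA).asIdeal := by
  let e : K ≃+* IsLocalRing.ResidueField Q.ring := RingEquiv.ofBijective _
    ⟨((IsLocalRing.residue Q.ring).comp Q.constants).injective, hQ⟩
  let i : A →+* Q.ring := A.val.toRingHom.codRestrict Q.ring fun x => hA x x.2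
  refine ⟨{ (e.symm : _ →+* K).comp ((IsLocalRing.residue Q.ring).comp i) with
    commutes' := fun c => e.symm_apply_apply c }, fun a => ?_⟩
  change e.symm (IsLocalRing.residue Q.ring (i a)) = 0 ↔ i a ∈ IsLocalRing.maximalIdeal Q.ring
  rw [map_eq_zero_iff _ e.symm.injective, IsLocalRing.residue_eq_zero_iff]

theorem mem_center_of_mem_nonunits {Q : ZariskiSpace K F} {A : Subalgebra K F}
    (hA : ∀ x ∈ A, x ∈ Q.ring) {a : A} (ha : (a : F) ∈ Q.ring.nonunits) :
    a ∈ (Q.center A hA).asIdeal := by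
  change (⟨a, hA a a.2⟩ : Q.ring) ∈ IsLocalRing.maximalIdeal Q.ring
  rw [ValuationSubring.valuation_lt_one_iff]
  exact (ValuationSubring.mem_nonunits_iff _).1 ha

/-- Near a rational place with smooth local uniformization, every independent family of power
series without constant term gives a rational place, on which the value group is lexicographic
and contains the values of the power series. -/
theorem exists_place_near {Q : ZariskiSpace K F} (hQ : Q.IsRational)
    (hQ' : Q.AdmitsSmoothLocalUniformization) {s t : Finset F} (h : Q ∈ patchBasic s t) :
    ∃ d : ℕ, Algebra.trdeg K F = d ∧ ∀ (m : ℕ) (b : Fin d → MvPowerSeries (Fin m) K),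
      (∀ i, MvPowerSeries.constantCoeff (b i) = 0) → AlgebraicIndependent K b →
      ∃ P : ZariskiSpace K F, P ∈ patchBasic s t ∧ P.IsRational ∧
        ∃ Φ : P.ValueGroup →* Multiplicative (Lex (Fin m → ℤ)), StrictMono Φ ∧
          ∀ i, ∃ u, ((Φ u : Multiplicative (Lex (Fin m → ℤ))) : MvPowerSeries.LexValues m) =
            MvPowerSeries.lexValuation K m (b i) := by
  classical
  obtain ⟨A, hA, hfg, hfrac, hmem, hsm⟩ := hQ' (s ∪ t) fun a ha =>
    (Finset.mem_union.1 ha).elim (h.1 a) fun ha => Q.ring.nonunits_subset (h.2 a ha)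
  obtain ⟨ρ, hρ⟩ := hQ.exists_residue A hA
  have : Algebra.IsSmoothAt K (Q.center A hA).asIdeal := hsm
  obtain ⟨d, hd, H⟩ := exists_powerSeries_embedding_of_isSmoothAt (F := F) A hfg ρ
    (Q.center A hA).asIdeal fun a => (hρ a).1
  refine ⟨d, hd, fun m b hb hbi => ?_⟩
  obtain ⟨φ, hφ, hφρ, hφb⟩ := H m b hb hbi
  obtain ⟨P, hPr, hPA, hPm, Φ, hΦ, hΦv⟩ := exists_place_of_embedding (F := F) φ hφ
  refine ⟨P, ⟨fun a ha => ?_, fun a ha => ?_⟩, hPr, Φ, hΦ, fun i => ?_⟩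
  · exact hPA ⟨a, hmem a (Finset.mem_union_left _ ha)⟩
  · refine hPm ⟨a, hmem a (Finset.mem_union_right _ ha)⟩ ?_
    -- The constant term of `φ a` is `ρ a`, which vanishes exactly on the center of `Q`.
    rw [hφρ, hρ]
    exact mem_center_of_mem_nonunits hA (h.2 a ha)
  · obtain ⟨a, s, hs, has⟩ := hφb i
    exact hΦv a s (b i) (hbi.ne_zero i) hs has

/-- A nontrivial subgroup of `ℤ` is infinite cyclic; `hu` excludes the trivial valuation. -/
theorem isDiscrete_of_strictMono {P : ZariskiSpace K F}
    (Φ : P.ValueGroup →* Multiplicative (Lex (Fin 1 → ℤ))) (hΦ : StrictMono Φ)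
    {u : P.ValueGroup} (hu : Φ u ≠ 1) : P.IsDiscrete := by
  let c : Multiplicative (Lex (Fin 1 → ℤ)) →* Multiplicative ℤ :=
    AddMonoidHom.toMultiplicative
      { toFun := fun v => ofLex v 0
        map_zero' := rfl
        map_add' := fun _ _ => rfl }
  have hc : Function.Injective c := fun v w hvw => by
    apply Multiplicative.toAdd.injective
    apply ofLex.injective
    funext i
    rw [Subsingleton.elim i 0]
    exact congrArg Multiplicative.toAdd hvw
  have hcyc : IsCyclic P.ValueGroup := isCyclic_of_injective (c.comp Φ) (hc.comp hΦ.injective)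
  have : Nontrivial P.ValueGroup := ⟨u, 1, fun h => hu (by rw [h, map_one])⟩
  exact LinearOrderedCommGroup.isCyclic_iff_nonempty_equiv_int.1 hcyc

/-- The values of the variables are, up to inversion, the standard generators of `ℤ^d`, so `Φ` is
onto and the rank can be computed in the lexicographic power. -/
theorem rank_eq_of_strictMono {P : ZariskiSpace K F} {d : ℕ}
    (Φ : P.ValueGroup →* Multiplicative (Lex (Fin d → ℤ))) (hΦ : StrictMono Φ)
    (hX : ∀ i, ∃ u, ((Φ u : Multiplicative (Lex (Fin d → ℤ))) : MvPowerSeries.LexValues d) =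
      MvPowerSeries.lexValuation K d (MvPowerSeries.X i)) : P.rank = d := by
  have hgen : ∀ i, Multiplicative.ofAdd (toLex (Pi.single i 1)) ∈ Φ.range := fun i => by
    obtain ⟨u, hu⟩ := hX i
    rw [MvPowerSeries.lexValuation_X, WithZero.coe_inj] at hu
    exact ⟨u⁻¹, by rw [map_inv, hu, ofAdd_neg, inv_inv]⟩
  let N : AddSubgroup (Fin d → ℤ) :=
    { carrier := {v | Multiplicative.ofAdd (toLex v) ∈ Φ.range}
      zero_mem' := Φ.range.one_mem
      add_mem' := Φ.range.mul_mem
      neg_mem' := Φ.range.inv_mem }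
  have hsurj : Function.Surjective Φ := fun x => by
    have hN : ofLex (Multiplicative.toAdd x) ∈ N := by
      rw [pi_eq_sum_univ' (ofLex (Multiplicative.toAdd x))]
      refine N.sum_mem fun i _ => N.zsmul_mem ?_ _
      exact hgen i
    exact hN
  let e : P.ValueGroup ≃*o Multiplicative (Lex (Fin d → ℤ)) :=
    { MulEquiv.ofBijective Φ ⟨hΦ.injective, hsurj⟩ with
      map_le_map_iff' := hΦ.le_iff_le }
  exact mk_convex_subgroups_eq e

end ZariskiSpace

theorem theorem1p6 {K F : Type*} [Field K] [Field F] [Algebra K F]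
    (hF : (⊤ : IntermediateField K F).FG) :
    (0 < Algebra.trdeg K F →
      {Q : ZariskiSpace K F | Q.IsRational ∧ Q.AdmitsSmoothLocalUniformization} ⊆
        closure {P : ZariskiSpace K F | P.IsRational ∧ P.IsDiscrete}) ∧
    {Q : ZariskiSpace K F | Q.IsRational ∧ Q.AdmitsSmoothLocalUniformization} ⊆
      closure {P : ZariskiSpace K F | P.IsRational ∧ P.IsOfMaximalRank} := by
  refine ⟨fun hpos => ?_, ?_⟩
  · rintro Q ⟨hQ, hQ'⟩
    rw [ZariskiSpace.isTopologicalBasis_patchBasic.mem_closure_iff]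
    rintro _ ⟨s, t, rfl⟩ hmem
    obtain ⟨d, hd, H⟩ := ZariskiSpace.exists_place_near hQ hQ' hmem
    obtain ⟨y, hy, hy0⟩ := MvPowerSeries.exists_algebraicIndependent K d
    obtain ⟨P, hP, hPr, Φ, hΦ, hΦy⟩ := H 1 y hy0 hy
    have hd0 : 0 < d := by rw [hd] at hpos; exact_mod_cast hpos
    -- Positive transcendence degree supplies at least one series; lacking a constant term, it has
    -- value less than 1.
    obtain ⟨u, hu⟩ := hΦy ⟨0, hd0⟩
    refine ⟨P, hP, hPr, ZariskiSpace.isDiscrete_of_strictMono Φ hΦ (u := u) fun h => ?_⟩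
    rw [h, WithZero.coe_one] at hu
    exact (MvPowerSeries.lexValuation_lt_one (hy0 _)).ne' hu
  · rintro Q ⟨hQ, hQ'⟩
    rw [ZariskiSpace.isTopologicalBasis_patchBasic.mem_closure_iff]
    rintro _ ⟨s, t, rfl⟩ hmem
    obtain ⟨d, hd, H⟩ := ZariskiSpace.exists_place_near hQ hQ' hmem
    obtain ⟨P, hP, hPr, Φ, hΦ, hΦX⟩ := H d MvPowerSeries.X
      (fun i => MvPowerSeries.constantCoeff_X i) (MvPowerSeries.algebraicIndependent_X K _)
    exact ⟨P, hP, hPr, (ZariskiSpace.rank_eq_of_strictMono Φ hΦ hΦX).trans hd.symm⟩
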